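/- Let $\omega=e^{i\pi/3}$. Starting from the directed unit segment from $0$ to $1$ in $\mathbb C$, iterate the following rule: each directed segment $\overrightarrow{AE}$ is replaced by $\overrightarrow{AB},\overrightarrow{BC},\overrightarrow{CD},\overrightarrow{DE}$, where $B=A+\frac{E-A}{3}$, $D=A+\frac{2(E-A)}{3}$, and $C=D+\omega(E-D)$ (so that $DEC$ is equilateral and lies to the left of $\overrightarrow{AE}$). Let $K_n$ be the set of endpoints of the segments after $n$ iterations; the Kochawave curve is $K=\overline{\bigcup_n K_n}$. Let $R$ be the region enclosed between $K$ and its base segment $[0,1]$, that is, the union of $K\cup[0,1]$ and the bounded connected components of its complement in $\mathbb C$. Let $m$ be the centroid of $R$ with respect to area. Then $R$ is compact and has positive finite area, and it is the union of the five parts $$\tfrac13R,\qquad \tfrac13\bigl(1+(1+\omega)R\bigr),\qquad \tfrac13\bigl(2+\omega-\omega R\bigr),\qquad \tfrac13\bigl(2+R\bigr),\qquad T,$$ where $T$ is the full triangle with vertices $\frac13,\frac{2+\omega}3,\frac23$. Any two of these parts overlap only in a set of area zero. The second part is a copy of $R$ at scale $1/\sqrt3$, and the first, third and fourth are copies at scale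 $1/3$. The areas of the five parts are respectively $\frac19,\frac13,\frac19,\frac19,\frac13$ of the area of $R$, and $m$ is the mean of the centroids of the parts with these weights. Consequently $m$ satisfies the linear equation $$m=\frac19\cdot\frac m3+\frac13\cdot\frac{1+(1+\omega)m}3+\frac19\cdot\frac{2+\omega-\omega m}3+\frac19\cdot\frac{2+m}3+\frac13\cdot\frac{\frac53+\frac\omega3}3,$$ whose unique solution in $\mathbb C$ is $$m=\frac{59+17\omega}{111}.$$ -/

import Mathlib

open MeasureTheory

namespace Kochawave

noncomputable section

/-- The sixth root of unity `ω = e^{iπ/3}`. -/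
def ω : ℂ := Complex.exp (Complex.I * Real.pi / 3)

/-- The construction rule: the directed segment from `A` to `E` is replaced by the directed
segments `AB`, `BC`, `CD`, `DE`, where `A, B, D, E` are equally spaced on the segment and `DEC` is
the equilateral triangle on `DE` that lies on the left of `AE`. A pair is (start, end). -/
def replaceSegment (s : ℂ × ℂ) : Set (ℂ × ℂ) :=
  let A := s.1
  let E := s.2
  let B := A + (E - A) / 3
  let D := A + 2 * (E - A) / 3
  let C := D + ω * (E - D)
  {(A, B), (B, C), (C, D), (D, E)}

/-- The directed segments after `n` iterations, starting from the unit segment. -/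
def segments : ℕ → Set (ℂ × ℂ)
  | 0 => {(0, 1)}
  | n + 1 => ⋃ s ∈ segments n, replaceSegment s

/-- The endpoints of the segments after `n` iterations (an increasing sequence of finite sets). -/
def endpoints (n : ℕ) : Set ℂ := {z | ∃ s ∈ segments n, z = s.1 ∨ z = s.2}

/-- The Kochawave curve: the closure of the limit (the union) of the sets of endpoints. -/
def curve : Set ℂ := closure (⋃ n, endpoints n)

/-- The set `Γ` together with everything it encloses, that is, together with the bounded connected
components of its complement. -/
def fill (Γ : Set ℂ) : Set ℂ :=
  Γ ∪ {z | z ∉ Γ ∧ Bornology.IsBounded (connectedComponentIn Γᶜ z)}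

/-- The region enclosed between the Kochawave curve and its base segment `[0, 1]`. -/
def region : Set ℂ := fill (curve ∪ segment ℝ 0 1)

/-- The centroid (mean position with respect to area) of a plane set. -/
def centroid (S : Set ℂ) : ℂ := ⨍ z in S, z ∂volume

/-- The similarity carrying the base segment `[0, 1]` to `[0, 1/3]`. -/
def simA (z : ℂ) : ℂ := z / 3

/-- The similarity carrying the base segment `[0, 1]` to `[1/3, (2+ω)/3]`. -/
def simB (z : ℂ) : ℂ := (1 + (1 + ω) * z) / 3

/-- The similarity carrying the base segment `[0, 1]` to `[(2+ω)/3, 2/3]`. -/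
def simC (z : ℂ) : ℂ := (2 + ω - ω * z) / 3

/-- The similarity carrying the base segment `[0, 1]` to `[2/3, 1]`. -/
def simD (z : ℂ) : ℂ := (2 + z) / 3

/-- The full triangle with vertices `1/3`, `(2+ω)/3`, `2/3`. -/
def triangle : Set ℂ := convexHull ℝ {1 / 3, (2 + ω) / 3, 2 / 3}

/-- The five parts of the dissection. -/
def part : Fin 5 → Set ℂ :=
  ![simA '' region, simB '' region, simC '' region, simD '' region, triangle]

/-- The weights (fractions of the area of the region) of the five parts. -/
def weight : Fin 5 → ℝ := ![1 / 9, 1 / 3, 1 / 9, 1 / 9, 1 / 3]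

/-- The linear equation for the centroid. -/
def CentroidEquation (m : ℂ) : Prop :=
  m = 1 / 9 * (m / 3)
    + 1 / 3 * ((1 + (1 + ω) * m) / 3)
    + 1 / 9 * ((2 + ω - ω * m) / 3)
    + 1 / 9 * ((2 + m) / 3)
    + 1 / 3 * ((5 / 3 + ω / 3) / 3)

end

end Kochawave

namespace Kochawave

/-! The region is identified with `solid`, the closure of all images of the full triangle under
words in the four similarities. This set is by construction the union of its four similar images and
the triangle, so only areas and topology remain.

Area: let Δ be the equilateral triangle on 0, 1, ω. The five parts give |solid| ≤ (2/3)|solid| +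
(1/9)|Δ|, hence |solid| ≤ |Δ|/3. The three rotations of `solid` about the centre of Δ cover Δ
(`bigTriangle_eq_iUnion_sector`), hence |Δ| ≤ 3|solid|. Thus |solid| = |Δ|/3, and equality in both
subadditivity bounds makes all overlaps null (`pairwise_solidPart`, `pairwise_sector`). Centroids
then add up with the area weights, which is the linear equation.

Topology: a point of `solid` off the curve and the base is interior to `solid`, so its complementary
component is trapped there (`solid_subset_region`). A point off `solid` is joined to infinity
avoiding `solid`: through a rotated copy and across its side of Δ, or directly in an outer half
plane (`region_subset_solid`). The null overlaps keep that path away from `solid`. -/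

/-! ### Inclusions proved by pulling back along contractions -/

/-- A point of `s` outside `t` can be pulled back inside `s`, and each pull-back divides the
distance to `t` by at least `c`; since `s` is bounded, that distance is 0. As `s` need not be
closed, the lemma applies to set differences. -/
theorem subset_of_contractions {E ι : Type*} [PseudoMetricSpace E] {s t : Set E} (f : ι → E → E)
    {c : ℝ} (hc0 : 0 < c) (hc1 : c < 1) (hf : ∀ i z w, dist (f i z) (f i w) ≤ c * dist z w)
    (hs : Bornology.IsBounded s) (ht : IsClosed t) (hne : t.Nonempty)
    (hmap : ∀ i, ∀ z ∈ t, f i z ∈ t)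
    (hcov : ∀ x ∈ s, x ∈ t ∨ ∃ i, ∃ y ∈ s, f i y = x) : s ⊆ t := by
  obtain ⟨y₀, hy₀⟩ := hne
  obtain ⟨M, hM⟩ := hs.subset_closedBall y₀
  have key : ∀ n : ℕ, ∀ x ∈ s, Metric.infDist x t ≤ c ^ n * |M| := by
    intro n
    induction n with
    | zero =>
      intro x hx
      have h1 : dist x y₀ ≤ M := hM hx
      simpa using (Metric.infDist_le_dist_of_mem hy₀).trans (h1.trans (le_abs_self M))
    | succ n ih =>
      intro x hx
      rcases hcov x hx with h | ⟨i, y, hy, rfl⟩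
      · rw [Metric.infDist_zero_of_mem h]
        positivity
      · have h2 : Metric.infDist (f i y) t / c ≤ Metric.infDist y t := by
          rw [Metric.le_infDist ⟨y₀, hy₀⟩]
          intro w hw
          rw [div_le_iff₀' hc0]
          exact (Metric.infDist_le_dist_of_mem (hmap i w hw)).trans (hf i y w)
        rw [div_le_iff₀' hc0] at h2
        calc _ ≤ c * Metric.infDist y t := h2
          _ ≤ c * (c ^ n * |M|) := by gcongr; exact ih y hy
          _ = _ := by ring
  intro x hx
  rw [ht.mem_iff_infDist_zero ⟨y₀, hy₀⟩]
  refine le_antisymm ?_ Metric.infDist_nonneg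
  have hlim : Filter.Tendsto (fun n : ℕ => c ^ n * |M|) Filter.atTop (nhds (0 * |M|)) :=
    (tendsto_pow_atTop_nhds_zero_of_lt_one hc0.le hc1).mul_const _
  rw [zero_mul] at hlim
  exact ge_of_tendsto' hlim fun n => key n x hx

/-! ### Oblique coordinates in the real basis 1, ω -/

theorem omega_eq : ω = ⟨1 / 2, √3 / 2⟩ := by
  have h : ω = Complex.exp ((Real.pi / 3 : ℝ) * Complex.I) := by
    rw [ω]; congr 1; push_cast; ring
  rw [h, Complex.exp_mul_I, ← Complex.ofReal_cos, ← Complex.ofReal_sin, Real.cos_pi_div_three,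
    Real.sin_pi_div_three]
  apply Complex.ext <;> simp

theorem omega_sq : ω ^ 2 = ω - 1 := by
  rw [omega_eq, sq]
  apply Complex.ext
  · simp; nlinarith [Real.sq_sqrt (show (0:ℝ) ≤ 3 by norm_num)]
  · simp; ring

theorem normSq_omega_combination (a b : ℝ) : ‖(a + b * ω : ℂ)‖ ^ 2 = a ^ 2 + a * b + b ^ 2 := by
  rw [← Complex.normSq_eq_norm_sq, Complex.normSq_apply, omega_eq]
  simp
  nlinarith [Real.sq_sqrt (show (0:ℝ) ≤ 3 by norm_num)]

/-- The coordinate of `z` along `1` in the real basis `1, ω`. -/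
noncomputable def coordX (z : ℂ) : ℝ := z.re - z.im / √3

/-- The coordinate of `z` along `ω` in the real basis `1, ω`. -/
noncomputable def coordY (z : ℂ) : ℝ := 2 * z.im / √3

@[fun_prop] theorem continuous_coordX : Continuous coordX := by unfold coordX; fun_prop
@[fun_prop] theorem continuous_coordY : Continuous coordY := by unfold coordY; fun_prop

@[simp] theorem coordX_add (z w : ℂ) : coordX (z + w) = coordX z + coordX w := by
  simp [coordX]; ring
@[simp] theorem coordY_add (z w : ℂ) : coordY (z + w) = coordY z + coordY w := by
  simp [coordY]; ring
@[simp] theorem coordX_sub (z w : ℂ) : coordX (z - w) = coordX z - coordX w := by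
  simp [coordX]; ring
@[simp] theorem coordY_sub (z w : ℂ) : coordY (z - w) = coordY z - coordY w := by
  simp [coordY]; ring
@[simp] theorem coordX_smul (r : ℝ) (z : ℂ) : coordX (r • z) = r * coordX z := by
  simp [coordX]; ring
@[simp] theorem coordY_smul (r : ℝ) (z : ℂ) : coordY (r • z) = r * coordY z := by
  simp [coordY]; ring
@[simp] theorem coordX_div_three (z : ℂ) : coordX (z / 3) = coordX z / 3 := by
  have : z / 3 = (1 / 3 : ℝ) • z := by rw [Complex.real_smul]; push_cast; ring
  rw [this, coordX_smul]; ring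
@[simp] theorem coordY_div_three (z : ℂ) : coordY (z / 3) = coordY z / 3 := by
  have : z / 3 = (1 / 3 : ℝ) • z := by rw [Complex.real_smul]; push_cast; ring
  rw [this, coordY_smul]; ring
@[simp] theorem coordX_ofReal (r : ℝ) : coordX r = r := by simp [coordX]
@[simp] theorem coordX_zero : coordX 0 = 0 := by simp [coordX]
@[simp] theorem coordY_zero : coordY 0 = 0 := by simp [coordY]
@[simp] theorem coordY_ofReal (r : ℝ) : coordY r = 0 := by simp [coordY]
@[simp] theorem coordX_one : coordX 1 = 1 := by simp [coordX]
@[simp] theorem coordY_one : coordY 1 = 0 := by simp [coordY]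
@[simp] theorem coordX_two : coordX 2 = 2 := by simp [coordX]
@[simp] theorem coordY_two : coordY 2 = 0 := by simp [coordY]
@[simp] theorem coordX_omega_mul (z : ℂ) : coordX (ω * z) = -coordY z := by
  have h3 : √3 ≠ 0 := by positivity
  have hs := Real.sq_sqrt (show (0:ℝ) ≤ 3 by norm_num)
  simp [coordX, coordY, omega_eq]
  field_simp
  linear_combination (-z.im) * hs
@[simp] theorem coordY_omega_mul (z : ℂ) : coordY (ω * z) = coordX z + coordY z := by
  have h3 : √3 ≠ 0 := by positivity
  simp [coordX, coordY, omega_eq]; field_simp; ring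
@[simp] theorem coordX_omega : coordX ω = 0 := by simpa using coordX_omega_mul 1
@[simp] theorem coordY_omega : coordY ω = 1 := by simpa using coordY_omega_mul 1

theorem ext_coord {z w : ℂ} (hX : coordX z = coordX w) (hY : coordY z = coordY w) : z = w := by
  have h3 : √3 ≠ 0 := by positivity
  simp only [coordX, coordY] at hX hY
  have him : z.im = w.im := by field_simp at hY; linarith
  rw [him] at hX
  exact Complex.ext (by linarith) him

@[simp] theorem coordX_simA (z : ℂ) : coordX (simA z) = coordX z / 3 := by simp [simA]
@[simp] theorem coordY_simA (z : ℂ) : coordY (simA z) = coordY z / 3 := by simp [simA]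
@[simp] theorem coordX_simB (z : ℂ) : coordX (simB z) = (1 + coordX z - coordY z) / 3 := by
  simp [simB, add_mul]; ring
@[simp] theorem coordY_simB (z : ℂ) : coordY (simB z) = (coordX z + 2 * coordY z) / 3 := by
  simp [simB, add_mul]; ring
@[simp] theorem coordX_simC (z : ℂ) : coordX (simC z) = (2 + coordY z) / 3 := by
  simp [simC]
@[simp] theorem coordY_simC (z : ℂ) : coordY (simC z) = (1 - coordX z - coordY z) / 3 := by
  simp [simC]; ring
@[simp] theorem coordX_simD (z : ℂ) : coordX (simD z) = (2 + coordX z) / 3 := by simp [simD]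
@[simp] theorem coordY_simD (z : ℂ) : coordY (simD z) = coordY z / 3 := by simp [simD]

/-- The rotation permuting the vertices `0 → 1 → ω → 0`. -/
noncomputable def rot (z : ℂ) : ℂ := 1 + (ω - 1) * z

@[simp] theorem coordX_rot (z : ℂ) : coordX (rot z) = 1 - coordX z - coordY z := by
  simp [rot, sub_mul]; ring
@[simp] theorem coordY_rot (z : ℂ) : coordY (rot z) = coordX z := by
  simp [rot, sub_mul]

/-- The four similarities of the construction. -/
noncomputable def sim : Fin 4 → ℂ → ℂ := ![simA, simB, simC, simD]

/-- The equilateral triangle with vertices `0, 1, ω`. -/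
def bigTriangle : Set ℂ := {z | 0 ≤ coordX z ∧ 0 ≤ coordY z ∧ coordX z + coordY z ≤ 1}

theorem mem_bigTriangle {z : ℂ} :
    z ∈ bigTriangle ↔ 0 ≤ coordX z ∧ 0 ≤ coordY z ∧ coordX z + coordY z ≤ 1 := Iff.rfl

theorem mem_triangle {z : ℂ} :
    z ∈ triangle ↔ 0 ≤ coordY z ∧ 1 / 3 ≤ coordX z - coordY z ∧ coordX z ≤ 2 / 3 := by
  constructor
  · intro hz
    have hconv : Convex ℝ
        {z : ℂ | 0 ≤ coordY z ∧ 1 / 3 ≤ coordX z - coordY z ∧ coordX z ≤ 2 / 3} := by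
      rintro z ⟨h1, h2, h3⟩ w ⟨k1, k2, k3⟩ a b ha hb hab
      obtain rfl : b = 1 - a := by linarith
      simp only [Set.mem_ofPred_eq, coordX_add, coordY_add, coordX_smul, coordY_smul]
      refine ⟨?_, ?_, ?_⟩ <;> nlinarith
    refine convexHull_min ?_ hconv hz
    rintro w (rfl | rfl | rfl) <;> simp <;> norm_num
  · rintro ⟨h1, h2, h3⟩
    -- The weights are the barycentric coordinates of `z` in the triangle.
    have hz : z = ∑ i : Fin 3, (![2 - 3 * coordX z, 3 * coordY z, 3 * coordX z - 3 * coordY z - 1] :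
        Fin 3 → ℝ) i • (![1 / 3, (2 + ω) / 3, 2 / 3] : Fin 3 → ℂ) i := by
      rw [Fin.sum_univ_three]
      apply ext_coord <;>
        simp only [coordX_add, coordY_add, coordX_smul, coordY_smul, Matrix.cons_val] <;>
        simp [-one_div] <;> ring
    rw [hz]
    refine (convex_convexHull ℝ _).sum_mem ?_ ?_ ?_
    · intro i _; fin_cases i <;> simp <;> linarith
    · rw [Fin.sum_univ_three]; simp; ring
    · intro i _
      apply subset_convexHull
      fin_cases i <;> simp

theorem mem_segment_zero_one {z : ℂ} :
    z ∈ segment ℝ (0 : ℂ) 1 ↔ coordY z = 0 ∧ 0 ≤ coordX z ∧ coordX z ≤ 1 := by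
  constructor
  · rintro ⟨a, b, ha, hb, hab, rfl⟩
    simp
    exact ⟨hb, by linarith⟩
  · rintro ⟨h1, h2, h3⟩
    refine ⟨1 - coordX z, coordX z, by linarith, h2, by ring, ?_⟩
    apply ext_coord <;> simp [h1]

theorem isClosed_bigTriangle : IsClosed bigTriangle :=
  (isClosed_le continuous_const continuous_coordX).inter
    ((isClosed_le continuous_const continuous_coordY).inter
      (isClosed_le (continuous_coordX.add continuous_coordY) continuous_const))

theorem isBounded_bigTriangle : Bornology.IsBounded bigTriangle := by
  refine (Metric.isBounded_iff_subset_closedBall 0).2 ⟨2, fun z hz => ?_⟩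
  rw [mem_closedBall_zero_iff]
  obtain ⟨h1, h2, h3⟩ := hz
  have hz : z = (coordX z : ℂ) + coordY z * ω := by
    apply ext_coord
    · rw [mul_comm]; simp
    · rw [mul_comm]; simp
  have := normSq_omega_combination (coordX z) (coordY z)
  rw [← hz] at this
  nlinarith [norm_nonneg z]

theorem isCompact_bigTriangle : IsCompact bigTriangle :=
  Metric.isCompact_of_isClosed_isBounded isClosed_bigTriangle isBounded_bigTriangle

theorem triangle_subset_bigTriangle : triangle ⊆ bigTriangle := by
  intro z hz
  rw [mem_triangle] at hz
  rw [mem_bigTriangle]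
  refine ⟨?_, ?_, ?_⟩ <;> linarith

theorem isClosed_triangle : IsClosed triangle := by
  have : triangle = {z | 0 ≤ coordY z ∧ 1 / 3 ≤ coordX z - coordY z ∧ coordX z ≤ 2 / 3} :=
    Set.ext fun z => mem_triangle
  rw [this]
  exact (isClosed_le continuous_const continuous_coordY).inter
    ((isClosed_le continuous_const (continuous_coordX.sub continuous_coordY)).inter
      (isClosed_le continuous_coordX continuous_const))

theorem sim_mem_bigTriangle (i : Fin 4) {z : ℂ} (hz : z ∈ bigTriangle) :
    sim i z ∈ bigTriangle := by
  obtain ⟨h1, h2, h3⟩ := hz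
  fin_cases i <;> simp [sim, mem_bigTriangle] <;> refine ⟨?_, ?_, ?_⟩ <;> linarith

theorem rot_mem_bigTriangle {z : ℂ} (hz : z ∈ bigTriangle) : rot z ∈ bigTriangle := by
  obtain ⟨h1, h2, h3⟩ := hz
  simp [mem_bigTriangle]; refine ⟨?_, ?_, ?_⟩ <;> linarith

/-! ### Affine maps, areas and centroids -/

/-- The coordinates `(coordX, coordY)` as a linear equivalence. -/
noncomputable def coordEquiv : ℂ ≃ₗ[ℝ] (Fin 2 → ℝ) where
  toFun z := ![coordX z, coordY z]
  map_add' z w := by simp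
  map_smul' r z := by simp only [coordX_smul, coordY_smul]; simp
  invFun v := v 0 + ω * v 1
  left_inv z := by apply ext_coord <;> simp
  right_inv v := by
    ext i
    fin_cases i <;> simp

/-- `g` is a real affine map of the plane whose linear part has determinant `d`. -/
def IsAffineWithDet (g : ℂ → ℂ) (d : ℝ) : Prop :=
  ∃ L : ℂ →L[ℝ] ℂ, L.det = d ∧ ∀ z, g z = L z + g 0

/-- The basis 1, ω is not orthonormal, but the determinant does not depend on the basis, so it can
be read off from the oblique coordinates. -/
theorem isAffineWithDet_of_coord {g : ℂ → ℂ} {d p q r s e f : ℝ}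
    (hX : ∀ z, coordX (g z) = p * coordX z + q * coordY z + e)
    (hY : ∀ z, coordY (g z) = r * coordX z + s * coordY z + f)
    (hd : p * s - q * r = d) : IsAffineWithDet g d := by
  set b := Module.Basis.ofEquivFun coordEquiv
  set L := Matrix.toLin b b !![p, q; r, s]
  have hL : ∀ z, coordEquiv (L z) = Matrix.mulVec !![p, q; r, s] (coordEquiv z) := by
    intro z
    have := Matrix.repr_toLin b b !![p, q; r, s] z
    ext i
    exact congrFun this i
  refine ⟨LinearMap.toContinuousLinearMap L, ?_, fun z => ?_⟩
  · rw [ContinuousLinearMap.det, LinearMap.coe_toContinuousLinearMap, LinearMap.det_toLin,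
      Matrix.det_fin_two_of, hd]
  · have h := hL z
    have h0 : coordX (L z) = p * coordX z + q * coordY z := by
      simpa [coordEquiv, Matrix.mulVec, dotProduct] using congrFun h 0
    have h1 : coordY (L z) = r * coordX z + s * coordY z := by
      simpa [coordEquiv, Matrix.mulVec, dotProduct] using congrFun h 1
    apply ext_coord
    · simp [hX, h0]
    · simp [hY, h1]

namespace IsAffineWithDet

variable {g : ℂ → ℂ} {d : ℝ}

theorem continuous (hg : IsAffineWithDet g d) : Continuous g := by
  obtain ⟨L, -, h⟩ := hg
  rw [funext h]
  fun_prop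

/-- An affine map with nonzero determinant is a homeomorphism. -/
theorem exists_homeomorph (hg : IsAffineWithDet g d) (hd : d ≠ 0) : ∃ e : ℂ ≃ₜ ℂ, ⇑e = g := by
  obtain ⟨L, hL, h⟩ := hg
  refine ⟨(ContinuousLinearEquiv.toHomeomorph (ContinuousLinearMap.toContinuousLinearEquivOfDetNeZero L
    (hL ▸ hd))).trans (Homeomorph.addRight (g 0)), ?_⟩
  ext1 z
  simp [h z]

theorem injective (hg : IsAffineWithDet g d) (hd : d ≠ 0) : Function.Injective g := by
  obtain ⟨e, rfl⟩ := hg.exists_homeomorph hd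
  exact e.injective

theorem volume_image (hg : IsAffineWithDet g d) (hd : d ≠ 0) {S : Set ℂ} (hS : MeasurableSet S) :
    volume (g '' S) = ENNReal.ofReal |d| * volume S := by
  have hinj := hg.injective hd
  obtain ⟨L, hL, h⟩ := hg
  rw [← lintegral_abs_det_fderiv_eq_addHaar_image volume hS (f' := fun _ => L) (fun z _ => ?_)
    hinj.injOn]
  · simp [hL]
  · rw [funext h]
    exact (L.hasFDerivAt.add_const _).hasFDerivWithinAt

theorem volumeReal_image (hg : IsAffineWithDet g d) (hd : d ≠ 0) {S : Set ℂ}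
    (hS : MeasurableSet S) : volume.real (g '' S) = |d| * volume.real S := by
  rw [measureReal_def, hg.volume_image hd hS, ENNReal.toReal_mul,
    ENNReal.toReal_ofReal (abs_nonneg d), measureReal_def]

/-- The constant Jacobian cancels against the scaling of the area, and averaging commutes with the
linear part and preserves constants. -/
theorem centroid_image (hg : IsAffineWithDet g d) (hd : d ≠ 0) {S : Set ℂ} (hS : IsCompact S)
    (hpos : 0 < volume S) : centroid (g '' S) = g (centroid S) := by
  have hinj := hg.injective hd
  have hvol := hg.volumeReal_image hd hS.measurableSet
  have hS0 : volume.real S ≠ 0 := (ENNReal.toReal_pos hpos.ne' hS.measure_lt_top.ne).ne'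
  obtain ⟨L, hL, h⟩ := hg
  have hint : IntegrableOn (fun z : ℂ => z) S volume :=
    continuous_id.continuousOn.integrableOn_compact hS
  rw [centroid, setAverage_eq, hvol, integral_image_eq_integral_abs_det_fderiv_smul volume
    hS.measurableSet (f' := fun _ => L) (fun z _ => ?_) hinj.injOn]
  · simp only [hL]
    rw [integral_smul, smul_smul, mul_inv, mul_comm, ← mul_assoc, mul_inv_cancel₀ (abs_ne_zero.2 hd), one_mul]
    obtain ⟨b, hb⟩ : ∃ b, ∀ z, g z = L z + b := ⟨_, h⟩
    simp only [hb]
    rw [integral_add (L.integrable_comp hint) (integrableOn_const hS.measure_lt_top.ne),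
      setIntegral_const, smul_add, smul_smul, inv_mul_cancel₀ hS0, one_smul,
      ContinuousLinearMap.integral_comp_comm L hint, centroid, setAverage_eq, map_smul]
  · rw [funext h]
    exact (L.hasFDerivAt.add_const _).hasFDerivWithinAt

end IsAffineWithDet

/-- Equality in finite subadditivity forces the sets to overlap in null sets. -/
theorem pairwise_measure_inter_eq_zero {α ι : Type*} [MeasurableSpace α] {μ : Measure α}
    [Fintype ι] {s : ι → Set α} (hs : ∀ i, MeasurableSet (s i))
    (hfin : μ (⋃ i, s i) ≠ ⊤) (hle : ∑ i, μ (s i) ≤ μ (⋃ i, s i)) :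
    Pairwise fun i j => μ (s i ∩ s j) = 0 := by
  classical
  intro i j hij
  -- All sets but `s j`: inclusion–exclusion for `t` and `s j` against subadditivity leaves no room
  -- for `μ (t ∩ s j)`.
  set t := ⋃ k ∈ Finset.univ.erase j, s k
  have ht : t ∪ s j = ⋃ k, s k := by
    ext x
    simp only [t, Set.mem_union, Set.mem_iUnion, Finset.mem_erase, Finset.mem_univ, and_true,
      exists_prop]
    constructor
    · rintro (⟨k, -, h⟩ | h)
      exacts [⟨k, h⟩, ⟨j, h⟩]
    · rintro ⟨k, h⟩
      by_cases hk : k = j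
      · exact .inr (hk ▸ h)
      · exact .inl ⟨k, hk, h⟩
  have h1 := measure_union_add_inter (μ := μ) t (hs j)
  have h2 : μ t ≤ ∑ k ∈ Finset.univ.erase j, μ (s k) := measure_biUnion_finset_le _ _
  rw [ht] at h1
  have h3 : μ (⋃ i, s i) + μ (t ∩ s j) ≤ μ (⋃ i, s i) + 0 := by
    rw [h1, add_zero]
    refine le_trans ?_ hle
    rw [← Finset.sum_erase_add _ _ (Finset.mem_univ j)]
    gcongr
  have h4 : μ (t ∩ s j) = 0 := le_antisymm ((ENNReal.add_le_add_iff_left hfin).1 h3) zero_le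
  refine measure_mono_null ?_ h4
  refine Set.inter_subset_inter_left _ fun x hx => ?_
  simp only [t, Set.mem_iUnion]
  exact ⟨i, by simp [hij], hx⟩

/-- The determinants of the four similarities. -/
noncomputable def simDet : Fin 4 → ℝ := ![1 / 9, 1 / 3, 1 / 9, 1 / 9]

theorem simDet_pos (i : Fin 4) : 0 < simDet i := by fin_cases i <;> simp [simDet]

theorem isAffineWithDet_sim (i : Fin 4) : IsAffineWithDet (sim i) (simDet i) := by
  fin_cases i
  · exact isAffineWithDet_of_coord (g := simA) (d := 1 / 9) (p := 1 / 3) (q := 0) (r := 0) (s := 1 / 3)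
      (e := 0) (f := 0) (fun z => by simp; ring) (fun z => by simp; ring) (by norm_num)
  · exact isAffineWithDet_of_coord (g := simB) (d := 1 / 3) (p := 1 / 3) (q := -1 / 3) (r := 1 / 3) (s := 2 / 3)
      (e := 1 / 3) (f := 0) (fun z => by simp; ring) (fun z => by simp; ring) (by norm_num)
  · exact isAffineWithDet_of_coord (g := simC) (d := 1 / 9) (p := 0) (q := 1 / 3) (r := -1 / 3) (s := -1 / 3)
      (e := 2 / 3) (f := 1 / 3) (fun z => by simp; ring) (fun z => by simp; ring) (by norm_num)
  · exact isAffineWithDet_of_coord (g := simD) (d := 1 / 9) (p := 1 / 3) (q := 0) (r := 0) (s := 1 / 3)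
      (e := 2 / 3) (f := 0) (fun z => by simp; ring) (fun z => by simp; ring) (by norm_num)

theorem isAffineWithDet_rot : IsAffineWithDet rot 1 := by
  exact isAffineWithDet_of_coord (g := rot) (p := -1) (q := -1) (r := 1) (s := 0)
    (e := 1) (f := 0) (fun z => by simp; ring) (fun z => by simp) (by norm_num)

/-- The affine map carrying `0, 1, ω` to `1/3, 2/3, (2+ω)/3`. -/
noncomputable def shear (z : ℂ) : ℂ := (1 + z + coordY z) / 3

theorem isAffineWithDet_shear : IsAffineWithDet shear (1 / 9) := by
  exact isAffineWithDet_of_coord (g := shear) (p := 1 / 3) (q := 1 / 3) (r := 0) (s := 1 / 3)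
    (e := 1 / 3) (f := 0) (fun z => by simp [shear]; ring) (fun z => by simp [shear]; ring) (by norm_num)

theorem shear_image_bigTriangle : shear '' bigTriangle = triangle := by
  ext w
  rw [mem_triangle]
  constructor
  · rintro ⟨z, ⟨h1, h2, h3⟩, rfl⟩
    simp [shear]
    refine ⟨?_, ?_, ?_⟩ <;> linarith
  · rintro ⟨h1, h2, h3⟩
    refine ⟨((3 * coordX w - 3 * coordY w - 1 : ℝ) : ℂ) + ω * ((3 * coordY w : ℝ) : ℂ),
      mem_bigTriangle.2 ?_, ?_⟩
    · simp only [coordX_add, coordY_add, coordX_ofReal, coordY_ofReal, coordX_omega_mul,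
        coordY_omega_mul]
      refine ⟨?_, ?_, ?_⟩ <;> linarith
    · apply ext_coord <;> simp only [shear, coordX_div_three, coordY_div_three, coordX_add,
        coordY_add, coordX_ofReal, coordY_ofReal, coordX_omega_mul, coordY_omega_mul, coordX_one,
        coordY_one] <;> ring

/-! ### Similarity ratios -/

theorem dist_coord_map {g : ℂ → ℂ} {a : ℂ} (h : ∀ z w, g z - g w = a * (z - w)) (z w : ℂ) :
    dist (g z) (g w) = ‖a‖ * dist z w := by
  rw [dist_eq_norm, h, norm_mul, dist_eq_norm]

theorem norm_omega : ‖ω‖ = 1 := by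
  have := normSq_omega_combination 0 1
  simp at this
  exact this.resolve_right fun h => by linarith [norm_nonneg ω]

theorem norm_one_add_omega : ‖1 + ω‖ = √3 := by
  have := normSq_omega_combination 1 1
  simp at this
  rw [← Real.sqrt_sq (norm_nonneg _), this]
  norm_num

theorem dist_simA (z w : ℂ) : dist (simA z) (simA w) = 1 / 3 * dist z w := by
  rw [dist_coord_map (a := 1 / 3) (fun z w => by simp [simA]; ring)]
  simp

theorem dist_simB (z w : ℂ) : dist (simB z) (simB w) = 1 / √3 * dist z w := by
  rw [dist_coord_map (a := (1 + ω) / 3) (fun z w => by simp [simB]; ring), norm_div,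
    norm_one_add_omega]
  congr 1
  have hs := Real.sq_sqrt (show (0:ℝ) ≤ 3 by norm_num)
  simp
  field_simp
  linarith

theorem dist_simC (z w : ℂ) : dist (simC z) (simC w) = 1 / 3 * dist z w := by
  rw [dist_coord_map (a := -ω / 3) (fun z w => by simp [simC]; ring), norm_div, norm_neg,
    norm_omega]
  simp

theorem dist_simD (z w : ℂ) : dist (simD z) (simD w) = 1 / 3 * dist z w := by
  rw [dist_coord_map (a := 1 / 3) (fun z w => by simp [simD]; ring)]
  simp

theorem one_third_le_inv_sqrt : (1 : ℝ) / 3 ≤ 1 / √3 := by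
  apply one_div_le_one_div_of_le (by positivity)
  rw [Real.sqrt_le_left (by norm_num)]
  norm_num

theorem inv_sqrt_lt_one : 1 / √3 < (1 : ℝ) := by
  rw [div_lt_one (by positivity), Real.lt_sqrt (by norm_num)]
  norm_num

theorem dist_sim_le (i : Fin 4) (z w : ℂ) : dist (sim i z) (sim i w) ≤ 1 / √3 * dist z w := by
  have h := mul_le_mul_of_nonneg_right one_third_le_inv_sqrt (dist_nonneg (x := z) (y := w))
  fin_cases i
  · exact (dist_simA z w).trans_le h
  · exact (dist_simB z w).le
  · exact (dist_simC z w).trans_le h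
  · exact (dist_simD z w).trans_le h

theorem dist_rot (z w : ℂ) : dist (rot z) (rot w) = dist z w := by
  rw [dist_coord_map (a := ω - 1) (fun z w => by simp [rot]; ring), ← omega_sq, norm_pow,
    norm_omega]
  simp

/-! ### The curve as an attractor -/

theorem replaceSegment_map {g : ℂ → ℂ} {a b : ℂ} (hg : ∀ z, g z = a * z + b) (s : ℂ × ℂ) :
    replaceSegment (Prod.map g g s) = Prod.map g g '' replaceSegment s := by
  simp only [replaceSegment, Set.image_insert_eq, Set.image_singleton, Prod.map_fst, Prod.map_snd,
    Prod.map_apply, hg]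
  ring_nf

theorem sim_affine (i : Fin 4) : ∃ a b : ℂ, ∀ z, sim i z = a * z + b := by
  fin_cases i
  · exact ⟨1 / 3, 0, fun z => by simp [sim, simA]; ring⟩
  · exact ⟨(1 + ω) / 3, 1 / 3, fun z => by simp [sim, simB]; ring⟩
  · exact ⟨-ω / 3, (2 + ω) / 3, fun z => by simp [sim, simC]; ring⟩
  · exact ⟨1 / 3, 2 / 3, fun z => by simp [sim, simD]; ring⟩

/-- The definition refines the finest segments last. Since the rule commutes with complex affine
maps, the first subdivision can be split off instead, which makes each stage four similar copies of
the preceding one. -/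
theorem segments_succ (n : ℕ) :
    segments (n + 1) = ⋃ i, Prod.map (sim i) (sim i) '' segments n := by
  induction n with
  | zero =>
    have h : segments 1 = replaceSegment (0, 1) := by simp [segments]
    have h' : (⋃ i, Prod.map (sim i) (sim i) '' segments 0) =
        {(simA 0, simA 1), (simB 0, simB 1), (simC 0, simC 1), (simD 0, simD 1)} := by
      ext s
      simp [segments, Fin.exists_fin_succ, sim, eq_comm]
    rw [h, h']
    simp only [replaceSegment, simA, simB, simC, simD]
    ring_nf
  | succ n ih =>
    have h : segments (n + 1 + 1) = ⋃ s ∈ segments (n + 1), replaceSegment s := rfl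
    rw [h, ih]
    have h' : segments (n + 1) = ⋃ s ∈ segments n, replaceSegment s := rfl
    simp only [Set.biUnion_iUnion, Set.biUnion_image]
    refine Set.iUnion_congr fun i => ?_
    obtain ⟨a, b, hab⟩ := sim_affine i
    simp only [replaceSegment_map hab]
    rw [← ih, h', Set.image_iUnion₂]

theorem mem_endpoints_succ {n : ℕ} {z : ℂ} :
    z ∈ endpoints (n + 1) ↔ ∃ i, ∃ w ∈ endpoints n, sim i w = z := by
  simp only [endpoints, segments_succ]
  constructor
  · rintro ⟨s, hs, h⟩
    obtain ⟨i, t, ht, rfl⟩ := Set.mem_iUnion.1 hs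
    rcases h with rfl | rfl
    · exact ⟨i, t.1, ⟨t, ht, .inl rfl⟩, rfl⟩
    · exact ⟨i, t.2, ⟨t, ht, .inr rfl⟩, rfl⟩
  · rintro ⟨i, w, ⟨t, ht, h⟩, rfl⟩
    refine ⟨Prod.map (sim i) (sim i) t, Set.mem_iUnion.2 ⟨i, t, ht, rfl⟩, ?_⟩
    rcases h with rfl | rfl
    exacts [.inl rfl, .inr rfl]

theorem mem_endpoints_zero {z : ℂ} : z ∈ endpoints 0 ↔ z = 0 ∨ z = 1 := by
  simp [endpoints, segments]

theorem continuous_sim (i : Fin 4) : Continuous (sim i) := (isAffineWithDet_sim i).continuous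

theorem sim_mem_curve (i : Fin 4) {z : ℂ} (hz : z ∈ curve) : sim i z ∈ curve := by
  have h : Set.MapsTo (sim i) (⋃ n, endpoints n) (⋃ n, endpoints n) := by
    intro w hw
    obtain ⟨n, hn⟩ := Set.mem_iUnion.1 hw
    exact Set.mem_iUnion.2 ⟨n + 1, mem_endpoints_succ.2 ⟨i, w, hn, rfl⟩⟩
  exact h.closure (continuous_sim i) hz

theorem zero_mem_curve : (0 : ℂ) ∈ curve :=
  subset_closure (Set.mem_iUnion.2 ⟨0, mem_endpoints_zero.2 (.inl rfl)⟩)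

/-! ### The solid attractor -/

/-- The orbit of a set under the four similarities. -/
inductive orbit (P : Set ℂ) : ℂ → Prop
  | base {z : ℂ} (hz : z ∈ P) : orbit P z
  | step (i : Fin 4) {z : ℂ} (hz : orbit P z) : orbit P (sim i z)

theorem orbit_subset {P Q : Set ℂ} (h : P ⊆ Q) (hQ : ∀ i, ∀ z ∈ Q, sim i z ∈ Q) :
    {z | orbit P z} ⊆ Q := by
  intro z hz
  induction hz with
  | base hz => exact h hz
  | step i _ ih => exact hQ i _ ih

/-- The closed set generated by the filled triangle under the four similarities. -/
def solid : Set ℂ := closure {z | orbit triangle z}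

theorem isClosed_solid : IsClosed solid := isClosed_closure

theorem solid_subset_bigTriangle : solid ⊆ bigTriangle :=
  closure_minimal (orbit_subset triangle_subset_bigTriangle fun i _ => sim_mem_bigTriangle i)
    isClosed_bigTriangle

theorem isCompact_solid : IsCompact solid :=
  isCompact_bigTriangle.of_isClosed_subset isClosed_solid solid_subset_bigTriangle

theorem sim_mem_solid (i : Fin 4) {z : ℂ} (hz : z ∈ solid) : sim i z ∈ solid := by
  have h : Set.MapsTo (sim i) {z | orbit triangle z} {z | orbit triangle z} :=
    fun w hw => orbit.step i hw
  exact h.closure (continuous_sim i) hz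

theorem triangle_subset_solid : triangle ⊆ solid :=
  fun _ hz => subset_closure (orbit.base hz)

/-- The triangle and four compact images form a closed set, so the recursion for the orbit survives
the closure. -/
theorem solid_cases {z : ℂ} (hz : z ∈ solid) : z ∈ triangle ∨ ∃ i, ∃ w ∈ solid, sim i w = z := by
  have hc : IsClosed (triangle ∪ ⋃ i, sim i '' solid) :=
    isClosed_triangle.union (isClosed_iUnion_of_finite fun i =>
      (isCompact_solid.image (continuous_sim i)).isClosed)
  have : solid ⊆ triangle ∪ ⋃ i, sim i '' solid := by
    refine closure_minimal ?_ hc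
    intro z hz
    cases hz with
    | base hz => exact .inl hz
    | step i hz => exact .inr (Set.mem_iUnion.2 ⟨i, _, subset_closure hz, rfl⟩)
  rcases this hz with h | h
  · exact .inl h
  · obtain ⟨i, w, hw, rfl⟩ := Set.mem_iUnion.1 h
    exact .inr ⟨i, w, hw, rfl⟩

theorem subset_of_sim {s t : Set ℂ} (hs : Bornology.IsBounded s) (ht : IsClosed t)
    (hne : t.Nonempty) (hmap : ∀ i, ∀ z ∈ t, sim i z ∈ t)
    (hcov : ∀ x ∈ s, x ∈ t ∨ ∃ i, ∃ y ∈ s, sim i y = x) : s ⊆ t :=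
  subset_of_contractions sim (by positivity) inv_sqrt_lt_one dist_sim_le hs ht hne hmap hcov

theorem nonempty_triangle : triangle.Nonempty :=
  ⟨1 / 3, subset_convexHull ℝ _ (by simp)⟩

theorem isBounded_segment : Bornology.IsBounded (segment ℝ (0 : ℂ) 1) := by
  refine isBounded_bigTriangle.subset fun z hz => ?_
  obtain ⟨h1, h2, h3⟩ := mem_segment_zero_one.1 hz
  exact mem_bigTriangle.2 ⟨h2, h1.ge, by linarith⟩

/-- A point of the base segment lies in the middle third or is the image of a base point. -/
theorem segment_cases {z : ℂ} (hz : z ∈ segment ℝ (0 : ℂ) 1) :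
    (coordY z = 0 ∧ 1 / 3 < coordX z ∧ coordX z < 2 / 3) ∨
      (∃ w ∈ segment ℝ (0 : ℂ) 1, sim 0 w = z) ∨ ∃ w ∈ segment ℝ (0 : ℂ) 1, sim 3 w = z := by
  obtain ⟨h1, h2, h3⟩ := mem_segment_zero_one.1 hz
  rcases le_or_gt (coordX z) (1 / 3) with h | h
  · refine .inr (.inl ⟨z + z + z, mem_segment_zero_one.2 ?_, ?_⟩)
    · simp only [coordX_add, coordY_add, h1]
      refine ⟨?_, ?_, ?_⟩ <;> linarith
    · simp [sim, simA]; ring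
  rcases lt_or_ge (coordX z) (2 / 3) with h' | h'
  · exact .inl ⟨h1, h, h'⟩
  · refine .inr (.inr ⟨z + z + z - 2, mem_segment_zero_one.2 ?_, ?_⟩)
    · simp only [coordX_add, coordY_add, coordX_sub, coordY_sub, coordX_two, coordY_two, h1]
      refine ⟨?_, ?_, ?_⟩ <;> linarith
    · simp [sim, simD]; ring

theorem segment_subset_solid : segment ℝ (0 : ℂ) 1 ⊆ solid := by
  refine subset_of_sim isBounded_segment isClosed_solid
    (nonempty_triangle.mono triangle_subset_solid) (fun i _ => sim_mem_solid i) fun x hx => ?_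
  rcases segment_cases hx with ⟨h1, h2, h3⟩ | ⟨w, hw, rfl⟩ | ⟨w, hw, rfl⟩
  · exact .inl (triangle_subset_solid (mem_triangle.2 ⟨h1.ge, by linarith, h3.le⟩))
  · exact .inr ⟨0, w, hw, rfl⟩
  · exact .inr ⟨3, w, hw, rfl⟩

theorem curve_subset_solid : curve ⊆ solid := by
  refine closure_minimal (Set.iUnion_subset fun n => ?_) isClosed_solid
  induction n with
  | zero =>
    intro z hz
    apply segment_subset_solid
    rcases mem_endpoints_zero.1 hz with rfl | rfl
    exacts [left_mem_segment _ _ _, right_mem_segment _ _ _]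
  | succ n ih =>
    intro z hz
    obtain ⟨i, w, hw, rfl⟩ := mem_endpoints_succ.1 hz
    exact sim_mem_solid i (ih hw)

theorem isClosed_curve : IsClosed curve := isClosed_closure

/-- A point of the solid attractor off the curve lies in some copy of the triangle. -/
theorem solid_subset_curve_union_orbit : solid ⊆ curve ∪ {z | orbit triangle z} := by
  -- Such a point is not in the triangle, and its preimage in `solid` is again outside the orbit, so
  -- the contraction lemma applies.
  have h : solid \ {z | orbit triangle z} ⊆ curve := by
    refine subset_of_sim (isCompact_solid.isBounded.subset Set.sdiff_subset) isClosed_curve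
      ⟨0, zero_mem_curve⟩ (fun i _ => sim_mem_curve i) fun x hx => ?_
    rcases solid_cases hx.1 with h | ⟨i, w, hw, rfl⟩
    · exact absurd (orbit.base h) hx.2
    · exact .inr ⟨i, w, ⟨hw, fun h => hx.2 (orbit.step i h)⟩, rfl⟩
  intro z hz
  by_cases hz' : orbit triangle z
  · exact .inr hz'
  · exact .inl (h ⟨hz, hz'⟩)

/-! ### Interior points of the solid attractor -/

/-- The open triangle. -/
def openTriangle : Set ℂ := {z | 0 < coordY z ∧ 1 / 3 < coordX z - coordY z ∧ coordX z < 2 / 3}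

theorem isOpen_openTriangle : IsOpen openTriangle :=
  (isOpen_lt continuous_const continuous_coordY).inter
    ((isOpen_lt continuous_const (continuous_coordX.sub continuous_coordY)).inter
      (isOpen_lt continuous_coordX continuous_const))

theorem openTriangle_subset_triangle : openTriangle ⊆ triangle :=
  fun _ hz => mem_triangle.2 ⟨hz.1.le, hz.2.1.le, hz.2.2.le⟩

theorem nonempty_openTriangle : openTriangle.Nonempty :=
  ⟨(5 / 9 : ℝ) + ω * (1 / 9 : ℝ), by
    simp only [openTriangle, Set.mem_ofPred_eq, coordX_add, coordY_add, coordX_ofReal,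
      coordY_ofReal, coordX_omega_mul, coordY_omega_mul]
    norm_num⟩

theorem triangle_subset_closure_openTriangle : triangle ⊆ closure openTriangle := by
  obtain ⟨c, hc⟩ := nonempty_openTriangle
  intro z hz
  rw [mem_triangle] at hz
  obtain ⟨z1, z2, z3⟩ := hz
  obtain ⟨c1, c2, c3⟩ := hc
  have hlim : Filter.Tendsto (fun t : ℝ => (1 - t) • z + t • c) (nhdsWithin 0 (Set.Ioi 0))
      (nhds z) := by
    have : Continuous fun t : ℝ => (1 - t) • z + t • c := by fun_prop
    have h := this.tendsto 0
    simp only [sub_zero, one_smul, zero_smul, add_zero] at h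
    exact h.mono_left nhdsWithin_le_nhds
  refine mem_closure_of_tendsto hlim ?_
  filter_upwards [Ioc_mem_nhdsGT (show (0:ℝ) < 1 by norm_num)] with t ht
  simp only [openTriangle, Set.mem_ofPred_eq, coordX_add, coordY_add, coordX_smul, coordY_smul]
  obtain ⟨ht0, ht1⟩ := ht
  refine ⟨?_, ?_, ?_⟩ <;> nlinarith

/-- This makes interior points dense in `solid`: any open set meeting `solid` overlaps it in
positive area. -/
theorem solid_subset_closure_openOrbit : solid ⊆ closure {z | orbit openTriangle z} := by
  refine closure_minimal ?_ isClosed_closure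
  refine orbit_subset (triangle_subset_closure_openTriangle.trans
    (closure_mono fun z hz => orbit.base hz)) fun i z hz => ?_
  have h : Set.MapsTo (sim i) {z | orbit openTriangle z} {z | orbit openTriangle z} :=
    fun w hw => orbit.step i hw
  exact h.closure (continuous_sim i) hz

/-- An affine image, with nonzero determinant, of an interior point is an interior point. -/
theorem IsAffineWithDet.image_mem_nhds {g : ℂ → ℂ} {d : ℝ} (hg : IsAffineWithDet g d) (hd : d ≠ 0)
    {s : Set ℂ} {z : ℂ} (hs : s ∈ nhds z) : g '' s ∈ nhds (g z) := by
  obtain ⟨e, rfl⟩ := hg.exists_homeomorph hd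
  exact e.isOpenMap.image_mem_nhds hs

theorem sim_mem_interior_solid (i : Fin 4) {z : ℂ} (hz : z ∈ interior solid) :
    sim i z ∈ interior solid := by
  rw [mem_interior_iff_mem_nhds] at hz ⊢
  refine Filter.mem_of_superset ((isAffineWithDet_sim i).image_mem_nhds (simDet_pos i).ne' hz) ?_
  rintro _ ⟨w, hw, rfl⟩
  exact sim_mem_solid i hw

theorem openTriangle_subset_interior_solid : openTriangle ⊆ interior solid :=
  interior_maximal (openTriangle_subset_triangle.trans triangle_subset_solid) isOpen_openTriangle

theorem openOrbit_subset_interior_solid : {z | orbit openTriangle z} ⊆ interior solid :=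
  orbit_subset openTriangle_subset_interior_solid fun i _ => sim_mem_interior_solid i

/-! ### Three rotated copies of the solid attractor tile the equilateral triangle -/

/-- `simB` fixes the centre of `rot`, so the two commute. With the next two identities, `simB` and
`simD` carry each rotated copy of `solid` into a rotated copy. -/
theorem simB_rot (z : ℂ) : simB (rot z) = rot (simB z) := by
  apply ext_coord <;> simp <;> ring

theorem simD_rot (z : ℂ) : simD (rot z) = rot (simA z) := by
  apply ext_coord <;> simp <;> ring

theorem simD_rot_rot (z : ℂ) : simD (rot (rot z)) = simC z := by
  apply ext_coord <;> simp <;> ring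

theorem rot_rot_rot (z : ℂ) : rot (rot (rot z)) = z := by
  apply ext_coord <;> simp <;> ring

/-- The three rotated copies of the solid attractor. -/
def sector (k : Fin 3) : Set ℂ := rot^[k] '' solid

theorem mem_iUnion_sector {z : ℂ} :
    z ∈ ⋃ k, sector k ↔ z ∈ solid ∨ (∃ w ∈ solid, rot w = z) ∨ ∃ w ∈ solid, rot (rot w) = z := by
  simp [sector, Fin.exists_fin_succ]

theorem rot_mem_iUnion_sector {z : ℂ} (hz : z ∈ ⋃ k, sector k) : rot z ∈ ⋃ k, sector k := by
  rw [mem_iUnion_sector] at hz ⊢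
  rcases hz with h | ⟨w, h, rfl⟩ | ⟨w, h, rfl⟩
  · exact .inr (.inl ⟨z, h, rfl⟩)
  · exact .inr (.inr ⟨w, h, rfl⟩)
  · rw [rot_rot_rot]; exact .inl h

theorem simB_mem_iUnion_sector {z : ℂ} (hz : z ∈ ⋃ k, sector k) : simB z ∈ ⋃ k, sector k := by
  rw [mem_iUnion_sector] at hz ⊢
  rcases hz with h | ⟨w, h, rfl⟩ | ⟨w, h, rfl⟩
  · exact .inl (sim_mem_solid 1 h)
  · exact .inr (.inl ⟨simB w, sim_mem_solid 1 h, (simB_rot w).symm⟩)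
  · exact .inr (.inr ⟨simB w, sim_mem_solid 1 h, by rw [simB_rot, simB_rot]⟩)

theorem simD_mem_iUnion_sector {z : ℂ} (hz : z ∈ ⋃ k, sector k) : simD z ∈ ⋃ k, sector k := by
  rw [mem_iUnion_sector] at hz ⊢
  rcases hz with h | ⟨w, h, rfl⟩ | ⟨w, h, rfl⟩
  · exact .inl (sim_mem_solid 3 h)
  · exact .inr (.inl ⟨simA w, sim_mem_solid 0 h, (simD_rot w).symm⟩)
  · rw [simD_rot_rot]; exact .inl (sim_mem_solid 2 h)

theorem isAffineWithDet_rot_iterate (k : ℕ) : IsAffineWithDet rot^[k] 1 := by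
  induction k with
  | zero => exact ⟨ContinuousLinearMap.id ℝ ℂ, by simp [ContinuousLinearMap.det], fun z => by simp⟩
  | succ k ih =>
    obtain ⟨L, hL, h⟩ := ih
    obtain ⟨M, hM, h'⟩ := isAffineWithDet_rot
    refine ⟨M.comp L, ?_, fun z => ?_⟩
    · rw [ContinuousLinearMap.det, ContinuousLinearMap.toLinearMap_comp, LinearMap.det_comp]
      rw [ContinuousLinearMap.det] at hL hM
      rw [hL, hM, one_mul]
    · rw [Function.iterate_succ_apply', Function.iterate_succ_apply', h, h', map_add, add_assoc,
        ← h', ContinuousLinearMap.comp_apply]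

theorem isCompact_sector (k : Fin 3) : IsCompact (sector k) :=
  isCompact_solid.image (isAffineWithDet_rot_iterate k).continuous

/-- A point of the equilateral triangle lies in its central copy or in one of three corners. -/
theorem bigTriangle_cases {z : ℂ} (hz : z ∈ bigTriangle) :
    (∃ w ∈ bigTriangle, simB w = z) ∨ ∃ k : Fin 3, ∃ u, rot^[k] u = z ∧
      (u ∈ triangle ∨ ∃ w ∈ bigTriangle, simD w = u) := by
  -- The line through 1/3 and (2+ω)/3 cuts off a corner of Δ at 1, which the line `coordX = 2/3`
  -- splits into the triangle and `simD '' bigTriangle`.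
  have corner : ∀ u ∈ bigTriangle, 1 / 3 ≤ coordX u - coordY u →
      (u ∈ triangle ∨ ∃ w ∈ bigTriangle, simD w = u) := by
    rintro u ⟨h1, h2, h3⟩ h4
    rcases le_total (coordX u) (2 / 3) with h | h
    · exact .inl (mem_triangle.2 ⟨h2, h4, h⟩)
    · refine .inr ⟨3 * u - 2, ?_, by simp [simD]⟩
      have e : 3 * u - 2 = u + u + u - 2 := by ring
      rw [e, mem_bigTriangle]
      simp only [coordX_sub, coordY_sub, coordX_add, coordY_add, coordX_two, coordY_two]
      refine ⟨?_, ?_, ?_⟩ <;> linarith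
  have hz2 := rot_mem_bigTriangle hz
  have hz3 := rot_mem_bigTriangle hz2
  by_cases c1 : 1 / 3 ≤ coordX z - coordY z
  · exact .inr ⟨0, z, rfl, corner z hz c1⟩
  by_cases c2 : 1 / 3 ≤ coordX (rot z) - coordY (rot z)
  · exact .inr ⟨2, rot z, rot_rot_rot z, corner _ hz2 c2⟩
  by_cases c3 : 1 / 3 ≤ coordX (rot (rot z)) - coordY (rot (rot z))
  · exact .inr ⟨1, rot (rot z), rot_rot_rot z, corner _ hz3 c3⟩
  simp only [coordX_rot, coordY_rot] at c1 c2 c3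
  -- The witness is the inverse image under `simB`; the three failed corner inequalities are exactly
  -- what places it in Δ.
  refine .inl ⟨((2 * coordX z + coordY z - 2 / 3 : ℝ) : ℂ) +
    ω * ((coordY z - coordX z + 1 / 3 : ℝ) : ℂ), ?_, ?_⟩
  · rw [mem_bigTriangle]
    simp only [coordX_add, coordY_add, coordX_ofReal, coordY_ofReal, coordX_omega_mul,
      coordY_omega_mul]
    refine ⟨?_, ?_, ?_⟩ <;> linarith
  · apply ext_coord <;> simp only [coordX_simB, coordY_simB, coordX_add, coordY_add,
      coordX_ofReal, coordY_ofReal, coordX_omega_mul, coordY_omega_mul] <;> ring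

theorem dist_rot_iterate (k : ℕ) (z w : ℂ) : dist (rot^[k] z) (rot^[k] w) = dist z w := by
  induction k generalizing z w with
  | zero => rfl
  | succ k ih => rw [Function.iterate_succ_apply, Function.iterate_succ_apply, ih, dist_rot]

theorem rot_iterate_mem {s : Set ℂ} (hs : ∀ z ∈ s, rot z ∈ s) (k : ℕ) {z : ℂ} (hz : z ∈ s) :
    rot^[k] z ∈ s :=
  Set.MapsTo.iterate (f := rot) (fun z hz => hs z hz) k hz

/-- Δ is covered by `simB '' bigTriangle`, three rotated triangles and three rotated copies of `simD
'' bigTriangle`. The union of the sectors contains those triangles and is stable under the four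
contractions involved; `none` indexes `simB`. -/
theorem bigTriangle_eq_iUnion_sector : bigTriangle = ⋃ k, sector k := by
  apply Set.Subset.antisymm
  · refine subset_of_contractions (ι := Option (Fin 3))
      (fun o => o.elim simB fun k z => rot^[k] (simD z)) (c := 1 / √3) (by positivity)
      inv_sqrt_lt_one ?_ isBounded_bigTriangle (isCompact_iUnion isCompact_sector).isClosed
      ?_ ?_ fun z hz => ?_
    · rintro (_ | k) z w
      · exact dist_sim_le 1 z w
      · exact (dist_rot_iterate _ _ _).trans_le (dist_sim_le 3 z w)
    · obtain ⟨z, hz⟩ := nonempty_triangle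
      exact ⟨z, mem_iUnion_sector.2 (.inl (triangle_subset_solid hz))⟩
    · rintro (_ | k) z hz
      · exact simB_mem_iUnion_sector hz
      · exact rot_iterate_mem (fun _ => rot_mem_iUnion_sector) k (simD_mem_iUnion_sector hz)
    · rcases bigTriangle_cases hz with ⟨w, hw, rfl⟩ | ⟨k, u, rfl, hu | ⟨w, hw, rfl⟩⟩
      · exact .inr ⟨none, w, hw, rfl⟩
      · exact .inl (rot_iterate_mem (fun _ => rot_mem_iUnion_sector) k
          (mem_iUnion_sector.2 (.inl (triangle_subset_solid hu))))
      · exact .inr ⟨some k, w, hw, rfl⟩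
  · refine Set.iUnion_subset fun k => ?_
    rintro _ ⟨z, hz, rfl⟩
    exact rot_iterate_mem (fun _ => rot_mem_bigTriangle) k (solid_subset_bigTriangle hz)

/-! ### Areas -/

theorem pairwise_inter_null_of_volumeReal_le {ι : Type*} [Fintype ι] {s : ι → Set ℂ}
    (hs : ∀ i, IsCompact (s i)) (hle : ∑ i, volume.real (s i) ≤ volume.real (⋃ i, s i)) :
    Pairwise fun i j => volume (s i ∩ s j) = 0 := by
  have hfin : volume (⋃ i, s i) ≠ ⊤ := (isCompact_iUnion hs).measure_lt_top.ne
  have hfin' : ∀ i ∈ Finset.univ, volume (s i) ≠ ⊤ := fun i _ => (hs i).measure_lt_top.ne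
  refine pairwise_measure_inter_eq_zero (fun i => (hs i).measurableSet) hfin ?_
  rw [← ENNReal.toReal_le_toReal (ENNReal.sum_ne_top.2 hfin') hfin, ENNReal.toReal_sum hfin']
  exact hle

theorem volumeReal_bigTriangle_pos : 0 < volume.real bigTriangle := by
  refine ENNReal.toReal_pos ?_ isCompact_bigTriangle.measure_lt_top.ne
  exact ((isOpen_openTriangle.measure_pos volume nonempty_openTriangle).trans_le (measure_mono
    (openTriangle_subset_triangle.trans triangle_subset_bigTriangle))).ne'

theorem isCompact_triangle : IsCompact triangle :=
  isCompact_bigTriangle.of_isClosed_subset isClosed_triangle triangle_subset_bigTriangle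

theorem volumeReal_triangle : volume.real triangle = 1 / 9 * volume.real bigTriangle := by
  rw [← shear_image_bigTriangle, isAffineWithDet_shear.volumeReal_image (by norm_num)
    isClosed_bigTriangle.measurableSet]
  norm_num

/-- The five parts of the dissection of the solid attractor. -/
def solidPart : Fin 5 → Set ℂ :=
  ![simA '' solid, simB '' solid, simC '' solid, simD '' solid, triangle]

theorem isCompact_solidPart (i : Fin 5) : IsCompact (solidPart i) := by
  fin_cases i
  · exact isCompact_solid.image (continuous_sim 0)
  · exact isCompact_solid.image (continuous_sim 1)
  · exact isCompact_solid.image (continuous_sim 2)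
  · exact isCompact_solid.image (continuous_sim 3)
  · exact isCompact_triangle

theorem solid_eq_iUnion_solidPart : solid = ⋃ i, solidPart i := by
  ext z
  rw [Set.mem_iUnion]
  constructor
  · intro hz
    rcases solid_cases hz with h | ⟨i, w, hw, rfl⟩
    · exact ⟨4, h⟩
    · fin_cases i
      exacts [⟨0, w, hw, rfl⟩, ⟨1, w, hw, rfl⟩, ⟨2, w, hw, rfl⟩, ⟨3, w, hw, rfl⟩]
  · rintro ⟨i, hi⟩
    fin_cases i
    · obtain ⟨w, hw, rfl⟩ := hi
      exact sim_mem_solid 0 hw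
    · obtain ⟨w, hw, rfl⟩ := hi
      exact sim_mem_solid 1 hw
    · obtain ⟨w, hw, rfl⟩ := hi
      exact sim_mem_solid 2 hw
    · obtain ⟨w, hw, rfl⟩ := hi
      exact sim_mem_solid 3 hw
    · exact triangle_subset_solid hi

theorem volumeReal_sim_image_solid (i : Fin 4) :
    volume.real (sim i '' solid) = simDet i * volume.real solid := by
  rw [(isAffineWithDet_sim i).volumeReal_image (simDet_pos i).ne' isClosed_solid.measurableSet,
    abs_of_pos (simDet_pos i)]

theorem sum_volumeReal_solidPart : ∑ i, volume.real (solidPart i) =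
    2 / 3 * volume.real solid + 1 / 9 * volume.real bigTriangle := by
  have h0 := volumeReal_sim_image_solid 0
  have h1 := volumeReal_sim_image_solid 1
  have h2 := volumeReal_sim_image_solid 2
  have h3 := volumeReal_sim_image_solid 3
  simp [sim, simDet] at h0 h1 h2 h3
  simp [Fin.sum_univ_five, solidPart, h0, h1, h2, h3, volumeReal_triangle]
  ring

theorem volumeReal_sector (k : Fin 3) : volume.real (sector k) = volume.real solid := by
  rw [sector, (isAffineWithDet_rot_iterate k).volumeReal_image one_ne_zero
    isClosed_solid.measurableSet, abs_one, one_mul]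

/-- Two subadditivity bounds meet: the five parts bound the area of `solid` above, the three
congruent sectors covering Δ bound it below. No disjointness is needed; it is deduced afterwards
from the equality. -/
theorem volumeReal_solid : volume.real solid = 1 / 3 * volume.real bigTriangle := by
  have h1 : volume.real solid ≤ ∑ i, volume.real (solidPart i) := by
    conv_lhs => rw [solid_eq_iUnion_solidPart]
    exact measureReal_iUnion_fintype_le _
  have h2 : volume.real bigTriangle ≤ ∑ k, volume.real (sector k) := by
    rw [bigTriangle_eq_iUnion_sector]
    exact measureReal_iUnion_fintype_le _
  rw [sum_volumeReal_solidPart] at h1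
  simp [volumeReal_sector] at h2
  linarith

theorem volumeReal_solid_pos : 0 < volume.real solid := by
  rw [volumeReal_solid]
  linarith [volumeReal_bigTriangle_pos]

theorem volume_solid_pos : 0 < volume solid :=
  (ENNReal.toReal_pos_iff.1 volumeReal_solid_pos).1

theorem pairwise_solidPart : Pairwise fun i j => volume (solidPart i ∩ solidPart j) = 0 := by
  refine pairwise_inter_null_of_volumeReal_le isCompact_solidPart ?_
  rw [← solid_eq_iUnion_solidPart, sum_volumeReal_solidPart, volumeReal_solid]
  linarith

theorem pairwise_sector : Pairwise fun i j => volume (sector i ∩ sector j) = 0 := by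
  refine pairwise_inter_null_of_volumeReal_le isCompact_sector ?_
  rw [← bigTriangle_eq_iUnion_sector]
  simp [volumeReal_sector, volumeReal_solid]

theorem volumeReal_solidPart (i : Fin 5) :
    volume.real (solidPart i) = weight i * volume.real solid := by
  fin_cases i
  · exact volumeReal_sim_image_solid 0
  · exact volumeReal_sim_image_solid 1
  · exact volumeReal_sim_image_solid 2
  · exact volumeReal_sim_image_solid 3
  · have := volumeReal_triangle
    have := volumeReal_solid
    simp [solidPart, weight]
    linarith

/-! ### Centroids -/

/-- Δ is invariant under `rot`, so its centroid is the only fixed point of `rot`. -/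
theorem centroid_bigTriangle : centroid bigTriangle = (1 + ω) / 3 := by
  have himg : rot '' bigTriangle = bigTriangle := by
    apply Set.Subset.antisymm
    · rintro _ ⟨z, hz, rfl⟩
      exact rot_mem_bigTriangle hz
    · intro z hz
      exact ⟨rot (rot z), rot_mem_bigTriangle (rot_mem_bigTriangle hz), rot_rot_rot z⟩
  have h := isAffineWithDet_rot.centroid_image one_ne_zero isCompact_bigTriangle
    (ENNReal.toReal_pos_iff.1 volumeReal_bigTriangle_pos).1
  rw [himg] at h
  have hX := congrArg coordX h
  have hY := congrArg coordY h
  simp only [coordX_rot, coordY_rot] at hX hY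
  apply ext_coord
  · simp; linarith
  · simp; linarith

theorem centroid_triangle : centroid triangle = (5 / 3 + ω / 3) / 3 := by
  rw [← shear_image_bigTriangle, isAffineWithDet_shear.centroid_image (by norm_num)
    isCompact_bigTriangle (ENNReal.toReal_pos_iff.1 volumeReal_bigTriangle_pos).1,
    centroid_bigTriangle, shear]
  simp
  ring

theorem centroid_sim_image_solid (i : Fin 4) :
    centroid (sim i '' solid) = sim i (centroid solid) :=
  (isAffineWithDet_sim i).centroid_image (simDet_pos i).ne' isCompact_solid volume_solid_pos

theorem integrableOn_id_of_isCompact {S : Set ℂ} (hS : IsCompact S) :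
    IntegrableOn (fun z : ℂ => z) S volume :=
  continuous_id.continuousOn.integrableOn_compact hS

theorem centroid_solid_eq_sum :
    centroid solid = ∑ i, (weight i : ℂ) * centroid (solidPart i) := by
  have h1 : ∫ z in solid, z = ∑ i, ∫ z in solidPart i, z := by
    conv_lhs => rw [solid_eq_iUnion_solidPart]
    rw [integral_iUnion_ae (fun i => (isCompact_solidPart i).measurableSet.nullMeasurableSet)
      pairwise_solidPart, tsum_fintype]
    rw [← solid_eq_iUnion_solidPart]
    exact integrableOn_id_of_isCompact isCompact_solid
  have hs := volumeReal_solid_pos.ne'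
  rw [centroid, setAverage_eq, h1, Finset.smul_sum]
  refine Finset.sum_congr rfl fun i _ => ?_
  have hw : weight i ≠ 0 := by fin_cases i <;> simp [weight]
  rw [centroid, setAverage_eq, volumeReal_solidPart, ← Complex.real_smul, smul_smul, mul_inv,
    ← mul_assoc, mul_inv_cancel₀ hw, one_mul]

theorem centroidEquation_solid : CentroidEquation (centroid solid) := by
  have h := centroid_solid_eq_sum
  have h0 := centroid_sim_image_solid 0
  have h1 := centroid_sim_image_solid 1
  have h2 := centroid_sim_image_solid 2
  have h3 := centroid_sim_image_solid 3
  simp [sim] at h0 h1 h2 h3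
  simp [Fin.sum_univ_five, solidPart, weight, h0, h1, h2, h3, centroid_triangle] at h
  simp only [simA, simB, simC, simD] at h
  rw [CentroidEquation]
  refine h.trans ?_
  ring

theorem centroidEquation_iff (m : ℂ) : CentroidEquation m ↔ m = (59 + 17 * ω) / 111 := by
  have hsq := omega_sq
  rw [CentroidEquation]
  constructor
  · intro h
    -- The equation reduces to (11 - ω)m = 6 + ω; the conjugate of 11 - ω is 10 + ω, and their
    -- product is 111.
    linear_combination (27 * (10 + ω) / 222) * h + ((1 + m) / 111) * hsq
  · rintro rfl
    linear_combination (-34 / 2997) * hsq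

/-! ### The region is the solid attractor -/

/-- The open half plane below the base line. -/
def lowerHalf : Set ℂ := {z | coordY z < 0}

theorem isOpen_lowerHalf : IsOpen lowerHalf := isOpen_lt continuous_coordY continuous_const

/-- The points of the open base segment near which the solid attractor fills the upper side. -/
def goodBase : Set ℂ :=
  {z | coordY z = 0 ∧ 0 < coordX z ∧ coordX z < 1 ∧ solid ∪ lowerHalf ∈ nhds z}

theorem middle_subset_goodBase {z : ℂ} (h1 : coordY z = 0) (h2 : 1 / 3 < coordX z)
    (h3 : coordX z < 2 / 3) : z ∈ goodBase := by
  refine ⟨h1, by linarith, by linarith, ?_⟩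
  have k1 : ∀ᶠ w in nhds z, 1 / 3 < coordX w - coordY w :=
    (continuous_coordX.sub continuous_coordY).continuousAt.eventually_const_lt
      (by simpa [h1] using h2)
  have k2 : ∀ᶠ w in nhds z, coordX w < 2 / 3 :=
    continuous_coordX.continuousAt.eventually_lt_const h3
  filter_upwards [k1, k2] with w hw1 hw2
  rcases lt_or_ge (coordY w) 0 with h | h
  · exact .inr h
  · exact .inl (triangle_subset_solid (mem_triangle.2 ⟨h, hw1.le, hw2.le⟩))

theorem sim_mem_goodBase {i : Fin 4} (hi : i = 0 ∨ i = 3) {z : ℂ} (hz : z ∈ goodBase) :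
    sim i z ∈ goodBase := by
  obtain ⟨h1, h2, h3, h4⟩ := hz
  have hY : ∀ w, coordY (sim i w) = coordY w / 3 := by
    rcases hi with rfl | rfl <;> intro w <;> simp [sim]
  refine ⟨by rw [hY, h1]; norm_num, ?_, ?_, ?_⟩
  · rcases hi with rfl | rfl <;> simp [sim] <;> linarith
  · rcases hi with rfl | rfl <;> simp [sim] <;> linarith
  · refine Filter.mem_of_superset
      ((isAffineWithDet_sim i).image_mem_nhds (simDet_pos i).ne' h4) ?_
    rintro _ ⟨w, hw | hw, rfl⟩
    · exact .inl (sim_mem_solid i hw)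
    · have : coordY w < 0 := hw
      refine .inr ?_
      change coordY (sim i w) < 0
      rw [hY]
      linarith

/-- These two maps send the base to the slanted sides of the triangle and the side below the base to
the triangle's side. Near the image point, the copy of `solid` and the triangle together fill a
neighbourhood. -/
theorem sim_goodBase_mem_interior {i : Fin 4} (hi : i = 1 ∨ i = 2) {z : ℂ} (hz : z ∈ goodBase) :
    sim i z ∈ interior solid := by
  obtain ⟨h1, h2, h3, h4⟩ := hz
  rw [mem_interior_iff_mem_nhds]
  have h5 := (isAffineWithDet_sim i).image_mem_nhds (simDet_pos i).ne' h4
  have k0 : ∀ᶠ w in nhds (sim i z), 0 < coordY w := by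
    refine continuous_coordY.continuousAt.eventually_const_lt ?_
    rcases hi with rfl | rfl <;> simp [sim] <;> linarith
  rcases hi with rfl | rfl
  · have k1 : ∀ᶠ w in nhds (sim 1 z), coordX w < 2 / 3 := by
      refine continuous_coordX.continuousAt.eventually_lt_const ?_
      simp [sim]
      linarith
    filter_upwards [h5, k0, k1]
    rintro _ ⟨w, hw | hw, rfl⟩ m0 m1
    · exact sim_mem_solid 1 hw
    · have hw' : coordY w < 0 := hw
      refine triangle_subset_solid (mem_triangle.2 ⟨m0.le, ?_, m1.le⟩)
      simp [sim]
      linarith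
  · have k1 : ∀ᶠ w in nhds (sim 2 z), 1 / 3 < coordX w - coordY w := by
      refine (continuous_coordX.sub continuous_coordY).continuousAt.eventually_const_lt ?_
      simp [sim]
      linarith
    filter_upwards [h5, k0, k1]
    rintro _ ⟨w, hw | hw, rfl⟩ m0 m1
    · exact sim_mem_solid 2 hw
    · have hw' : coordY w < 0 := hw
      refine triangle_subset_solid (mem_triangle.2 ⟨m0.le, m1.le, ?_⟩)
      simp [sim]
      linarith

/-- The open middle third is good, and goodness passes through `simA` and `simD`, so a bad point
pulls back to a bad point and the contraction lemma puts it on the curve. -/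
theorem segment_subset_curve_union_goodBase : segment ℝ (0 : ℂ) 1 ⊆ curve ∪ goodBase := by
  have h : segment ℝ (0 : ℂ) 1 \ goodBase ⊆ curve := by
    refine subset_of_sim (isBounded_segment.subset Set.sdiff_subset) isClosed_curve
      ⟨0, zero_mem_curve⟩ (fun i _ => sim_mem_curve i) fun x hx => ?_
    rcases segment_cases hx.1 with ⟨h1, h2, h3⟩ | ⟨w, hw, rfl⟩ | ⟨w, hw, rfl⟩
    · exact absurd (middle_subset_goodBase h1 h2 h3) hx.2
    · exact .inr ⟨0, w, ⟨hw, fun h => hx.2 (sim_mem_goodBase (.inl rfl) h)⟩, rfl⟩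
    · exact .inr ⟨3, w, ⟨hw, fun h => hx.2 (sim_mem_goodBase (.inr rfl) h)⟩, rfl⟩
  intro z hz
  by_cases hz' : z ∈ goodBase
  · exact .inr hz'
  · exact .inl (h ⟨hz, hz'⟩)

theorem goodBase_subset_segment : goodBase ⊆ segment ℝ (0 : ℂ) 1 :=
  fun _ hz => mem_segment_zero_one.2 ⟨hz.1, hz.2.1.le, hz.2.2.1.le⟩

theorem triangle_subset_curve_union : triangle ⊆ curve ∪ (goodBase ∪ interior solid) := by
  intro z hz
  obtain ⟨h1, h2, h3⟩ := mem_triangle.1 hz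
  -- The slanted sides of the triangle are the images of the base under `simB` and `simC`.
  have side : ∀ i : Fin 4, (i = 1 ∨ i = 2) → ∀ w ∈ segment ℝ (0 : ℂ) 1, sim i w = z →
      z ∈ curve ∪ (goodBase ∪ interior solid) := by
    rintro i hi w hw rfl
    rcases segment_subset_curve_union_goodBase hw with h | h
    · exact .inl (sim_mem_curve i h)
    · exact .inr (.inr (sim_goodBase_mem_interior hi h))
  rcases h2.eq_or_lt with h2 | h2
  · refine side 1 (.inl rfl) ((3 * coordX z - 1 : ℝ) : ℂ) (mem_segment_zero_one.2 ?_) ?_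
    · rw [coordX_ofReal, coordY_ofReal]
      refine ⟨rfl, ?_, ?_⟩ <;> linarith
    · change simB _ = z
      apply ext_coord <;> simp only [coordX_simB, coordY_simB, coordX_ofReal, coordY_ofReal] <;>
        linarith
  rcases h3.eq_or_lt with h3 | h3
  · refine side 2 (.inr rfl) ((1 - 3 * coordY z : ℝ) : ℂ) (mem_segment_zero_one.2 ?_) ?_
    · rw [coordX_ofReal, coordY_ofReal]
      refine ⟨rfl, ?_, ?_⟩ <;> linarith
    · change simC _ = z
      apply ext_coord <;> simp only [coordX_simC, coordY_simC, coordX_ofReal, coordY_ofReal] <;>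
        linarith
  rcases h1.eq_or_lt with h1 | h1
  · exact .inr (.inl (middle_subset_goodBase h1.symm (by linarith) h3))
  · exact .inr (.inr (openTriangle_subset_interior_solid ⟨h1, h2, h3⟩))

theorem solid_subset_curve_union : solid ⊆ curve ∪ (goodBase ∪ interior solid) := by
  intro z hz
  rcases solid_subset_curve_union_orbit hz with h | h
  · exact .inl h
  · refine orbit_subset triangle_subset_curve_union (fun i w hw => ?_) h
    rcases hw with hw | hw | hw
    · exact .inl (sim_mem_curve i hw)
    · have : (i = 0 ∨ i = 3) ∨ (i = 1 ∨ i = 2) := by fin_cases i <;> simp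
      rcases this with hi | hi
      · exact .inr (.inl (sim_mem_goodBase hi hw))
      · exact .inr (.inr (sim_goodBase_mem_interior hi hw))
    · exact .inr (.inr (sim_mem_interior_solid i hw))

theorem mem_interior_solid {z : ℂ} (hz : z ∈ solid) (h : z ∉ curve ∪ segment ℝ 0 1) :
    z ∈ interior solid := by
  rcases solid_subset_curve_union hz with hz | hz | hz
  · exact absurd (.inl hz) h
  · exact absurd (.inr (goodBase_subset_segment hz)) h
  · exact hz

/-- Off the curve and the base, `solid` coincides with its interior and is therefore relatively
clopen, so a complementary component meeting it stays inside and is bounded. -/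
theorem solid_subset_region : solid ⊆ region := by
  intro z hz
  by_cases hz' : z ∈ curve ∪ segment ℝ 0 1
  · exact .inl hz'
  refine .inr ⟨hz', isCompact_solid.isBounded.subset (Set.Subset.trans ?_ interior_subset)⟩
  refine isPreconnected_connectedComponentIn.subset_of_closure_inter_subset isOpen_interior
    ⟨z, mem_connectedComponentIn hz', mem_interior_solid hz hz'⟩ ?_
  rintro w ⟨hw1, hw2⟩
  exact mem_interior_solid (closure_minimal interior_subset isClosed_solid hw1)
    (connectedComponentIn_subset _ _ hw2)

/-! ### Escaping to infinity through the rotated copies -/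

/-- The good base point in the middle of the base. -/
theorem half_mem_goodBase : ((1 / 2 : ℝ) : ℂ) ∈ goodBase := by
  apply middle_subset_goodBase <;> simp only [coordX_ofReal, coordY_ofReal] <;> norm_num

/-- A segment from an interior point of the solid in the triangle, off its base, to the middle of
the base stays inside. -/
theorem segment_half_subset {z : ℂ} (hz : z ∈ interior solid) (h1 : 0 < coordY z)
    (h2 : 1 / 3 ≤ coordX z - coordY z) (h3 : coordX z ≤ 2 / 3) :
    segment ℝ z ((1 / 2 : ℝ) : ℂ) ⊆ interior solid ∪ goodBase := by
  rintro _ ⟨a, b, ha, hb, hab, rfl⟩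
  obtain rfl : b = 1 - a := by linarith
  rcases ha.eq_or_lt with rfl | ha
  · simpa using Or.inr half_mem_goodBase
  rcases hb.eq_or_lt with hb' | hb
  · have : a = 1 := by linarith
    subst this
    simpa using Or.inl hz
  · refine .inl (openTriangle_subset_interior_solid ?_)
    simp only [openTriangle, Set.mem_ofPred_eq, coordX_add, coordY_add, coordX_smul, coordY_smul,
      coordX_ofReal, coordY_ofReal]
    refine ⟨?_, ?_, ?_⟩ <;> nlinarith

/-- Every point of an open copy of the triangle can be joined to the base inside the solid. -/
theorem exists_preconnected_of_openOrbit {z : ℂ} (hz : orbit openTriangle z) :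
    ∃ S ⊆ interior solid ∪ goodBase, IsPreconnected S ∧ z ∈ S ∧ (S ∩ goodBase).Nonempty := by
  induction hz with
  | @base z hz =>
    exact ⟨_, segment_half_subset (openTriangle_subset_interior_solid hz) hz.1 hz.2.1.le hz.2.2.le,
      (convex_segment _ _).isPreconnected, left_mem_segment _ _ _, _, right_mem_segment _ _ _,
      half_mem_goodBase⟩
  | @step i z _ ih =>
    obtain ⟨S, hS, hconn, hzS, p, hpS, hp⟩ := ih
    have hconn' := hconn.image (sim i) (continuous_sim i).continuousOn
    have : (i = 0 ∨ i = 3) ∨ (i = 1 ∨ i = 2) := by fin_cases i <;> simp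
    rcases this with hi | hi
    · refine ⟨sim i '' S, ?_, hconn', ⟨z, hzS, rfl⟩, sim i p, ⟨p, hpS, rfl⟩,
        sim_mem_goodBase hi hp⟩
      rintro _ ⟨w, hw, rfl⟩
      rcases hS hw with h | h
      · exact .inl (sim_mem_interior_solid i h)
      · exact .inr (sim_mem_goodBase hi h)
    -- Here the image of the good point lies on a slanted side of the triangle, not on the base; a
    -- segment through the triangle leads on to the midpoint 1/2.
    · have hpi := sim_goodBase_mem_interior hi hp
      obtain ⟨p1, p2, p3, -⟩ := hp
      refine ⟨sim i '' S ∪ segment ℝ (sim i p) ((1 / 2 : ℝ) : ℂ), Set.union_subset ?_ ?_,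
        hconn'.union (sim i p) ⟨p, hpS, rfl⟩ (left_mem_segment _ _ _)
          (convex_segment _ _).isPreconnected,
        .inl ⟨z, hzS, rfl⟩, _, .inr (right_mem_segment _ _ _), half_mem_goodBase⟩
      · rintro _ ⟨w, hw, rfl⟩
        rcases hS hw with h | h
        · exact .inl (sim_mem_interior_solid i h)
        · exact .inl (sim_goodBase_mem_interior hi h)
      · apply segment_half_subset hpi <;> rcases hi with rfl | rfl <;> simp [sim] <;> linarith

theorem convex_lowerHalf : Convex ℝ lowerHalf := by
  intro z hz w hw a b ha hb hab
  have hz' : coordY z < 0 := hz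
  have hw' : coordY w < 0 := hw
  change coordY (a • z + b • w) < 0
  rw [coordY_add, coordY_smul, coordY_smul]
  obtain rfl : b = 1 - a := by linarith
  rcases ha.eq_or_lt with rfl | ha
  · simpa using hw'
  · nlinarith

theorem goodBase_subset_closure_lowerHalf : goodBase ⊆ closure lowerHalf := by
  intro z hz
  have hlim : Filter.Tendsto (fun t : ℝ => z - t • ω) (nhdsWithin 0 (Set.Ioi 0)) (nhds z) := by
    have : Continuous fun t : ℝ => z - t • ω := by fun_prop
    have h := this.tendsto 0
    simp only [zero_smul, sub_zero] at h
    exact h.mono_left nhdsWithin_le_nhds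
  refine mem_closure_of_tendsto hlim ?_
  filter_upwards [self_mem_nhdsWithin] with t ht
  have ht' : 0 < t := ht
  change coordY (z - t • ω) < 0
  rw [coordY_sub, coordY_smul, hz.1, coordY_omega]
  linarith

/-- A good base point is a limit of the lower half plane and has a neighbourhood in `solid ∪
lowerHalf`, so the path to the base can be glued there to the half plane. -/
theorem exists_preconnected_lowerHalf {z : ℂ} (hz : orbit openTriangle z) :
    ∃ S ⊆ interior (solid ∪ lowerHalf), IsPreconnected S ∧ z ∈ S ∧ lowerHalf ⊆ S := by
  obtain ⟨S, hS, hconn, hzS, p, hpS, hp⟩ := exists_preconnected_of_openOrbit hz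
  have hins : IsPreconnected (insert p lowerHalf) :=
    convex_lowerHalf.isPreconnected.subset_closure (Set.subset_insert _ _)
      (Set.insert_subset (goodBase_subset_closure_lowerHalf hp) subset_closure)
  have hgood : goodBase ⊆ interior (solid ∪ lowerHalf) :=
    fun w hw => mem_interior_iff_mem_nhds.2 hw.2.2.2
  refine ⟨S ∪ insert p lowerHalf, Set.union_subset ?_ (Set.insert_subset (hgood hp) ?_),
    hconn.union p hpS (Set.mem_insert _ _) hins, .inl hzS,
    (Set.subset_insert _ _).trans Set.subset_union_right⟩
  · exact hS.trans (Set.union_subset (interior_mono Set.subset_union_left) hgood)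
  · exact interior_maximal Set.subset_union_right isOpen_lowerHalf

theorem sector_zero : sector 0 = solid := by simp [sector]

theorem disjoint_bigTriangle_image_lowerHalf (k : Fin 3) :
    Disjoint bigTriangle (rot^[k] '' lowerHalf) := by
  rw [Set.disjoint_right]
  rintro _ ⟨w, hw, rfl⟩ ⟨a1, a2, a3⟩
  have hw' : coordY w < 0 := hw
  fin_cases k <;> simp at a1 a2 a3 <;> linarith

/-- The solid attractor misses the interior of a rotated copy of itself joined with the outer half
plane along the rotated base. -/
theorem disjoint_rot_interior {k : Fin 3} (hk : k ≠ 0) :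
    Disjoint solid (rot^[k] '' interior (solid ∪ lowerHalf)) := by
  obtain ⟨e, he⟩ := (isAffineWithDet_rot_iterate k).exists_homeomorph one_ne_zero
  have hopen : IsOpen (rot^[k] '' interior (solid ∪ lowerHalf)) := by
    rw [← he]
    exact e.isOpenMap _ isOpen_interior
  rw [Set.disjoint_left]
  intro z hz hz'
  -- A common point would give an overlap of positive area with `solid`. The rotated half plane
  -- misses Δ, so that overlap lies in two distinct sectors, whose intersection is null.
  obtain ⟨w, hw1, hw2⟩ := mem_closure_iff.1 (solid_subset_closure_openOrbit hz) _ hopen hz'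
  have hpos := (hopen.inter (isOpen_interior (s := solid))).measure_pos volume
    ⟨w, hw1, openOrbit_subset_interior_solid hw2⟩
  refine hpos.ne' (measure_mono_null ?_ (pairwise_sector hk))
  rintro _ ⟨⟨u, hu, rfl⟩, hu2⟩
  have hu3 := interior_subset hu2
  refine ⟨?_, by rwa [sector_zero]⟩
  rcases interior_subset hu with h | h
  · exact ⟨u, h, rfl⟩
  · exact absurd ⟨u, h, rfl⟩ (Set.disjoint_left.1 (disjoint_bigTriangle_image_lowerHalf k)
      (solid_subset_bigTriangle hu3))

theorem not_isBounded_image_lowerHalf (k : ℕ) : ¬ Bornology.IsBounded (rot^[k] '' lowerHalf) := by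
  intro h
  obtain ⟨C, hC⟩ := Metric.isBounded_iff.1 h
  have hm : ∀ t : ℝ, -(1 : ℂ) * ω + t ∈ lowerHalf := fun t => by
    change coordY _ < 0
    rw [neg_one_mul, ← sub_eq_neg_add]
    simp
  have h1 := hC ⟨_, hm 0, rfl⟩ ⟨_, hm (|C| + 1), rfl⟩
  rw [dist_rot_iterate, dist_add_left, Complex.dist_of_im_eq (by simp)] at h1
  simp only [Complex.ofReal_re, Real.dist_eq, zero_sub, abs_neg] at h1
  linarith [le_abs_self C, le_abs_self (|C| + 1)]

theorem exists_mem_image_lowerHalf {z : ℂ} (hz : z ∉ bigTriangle) :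
    ∃ k : Fin 3, z ∈ rot^[k] '' lowerHalf := by
  by_cases h2 : coordY z < 0
  · exact ⟨0, z, h2, rfl⟩
  by_cases h1 : coordX z < 0
  · exact ⟨2, rot z, by simpa [lowerHalf] using h1, rot_rot_rot z⟩
  · refine ⟨1, rot (rot z), ?_, rot_rot_rot z⟩
    by_contra h3
    simp [lowerHalf] at h3
    exact hz ⟨not_lt.1 h1, not_lt.1 h2, by linarith⟩

theorem region_subset_solid : region ⊆ solid := by
  have hΓ : curve ∪ segment ℝ 0 1 ⊆ solid := Set.union_subset curve_subset_solid segment_subset_solid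
  rintro z (hz | ⟨-, hbdd⟩)
  · exact hΓ hz
  by_contra hzs
  -- A connected set through `z` that avoids `solid` lies in the bounded component of `z`, so it
  -- cannot contain a half plane.
  have key : ∀ (k : ℕ) (S : Set ℂ), IsPreconnected S → z ∈ S → Disjoint solid S →
      ¬ rot^[k] '' lowerHalf ⊆ S := fun k S hS hzS hd hk =>
    not_isBounded_image_lowerHalf k (hbdd.subset
      (hk.trans (hS.subset_connectedComponentIn hzS (hd.mono_left hΓ).subset_compl_left)))
  by_cases hzb : z ∈ bigTriangle
  · rw [bigTriangle_eq_iUnion_sector] at hzb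
    obtain ⟨k, y, hy, rfl⟩ := Set.mem_iUnion.1 hzb
    have hk : k ≠ 0 := by
      rintro rfl
      exact hzs hy
    have hcont := (isAffineWithDet_rot_iterate k).continuous
    -- The point may lie in no rotated open triangle copy; a small ball around it avoiding `solid`
    -- connects it to a point that does.
    obtain ⟨ε, hε, hball⟩ := Metric.isOpen_iff.1 isClosed_solid.isOpen_compl _ hzs
    obtain ⟨u, hu1, hu2⟩ := mem_closure_iff.1 (solid_subset_closure_openOrbit hy) _
      (Metric.isOpen_ball.preimage hcont) (Metric.mem_ball_self hε)
    obtain ⟨S, hS, hconn, huS, hlow⟩ := exists_preconnected_lowerHalf hu2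
    refine key (k : ℕ) (Metric.ball (rot^[k] y) ε ∪ rot^[k] '' S)
      ((convex_ball _ _).isPreconnected.union _ hu1 ⟨u, huS, rfl⟩
        (hconn.image _ hcont.continuousOn)) (.inl (Metric.mem_ball_self hε)) ?_
      ((Set.image_mono hlow).trans Set.subset_union_right)
    exact Set.disjoint_union_right.2 ⟨Set.subset_compl_iff_disjoint_left.1 hball,
      (disjoint_rot_interior hk).mono_right (Set.image_mono hS)⟩
  · obtain ⟨k, hk⟩ := exists_mem_image_lowerHalf hzb
    exact key k _ (convex_lowerHalf.isPreconnected.image _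
      (isAffineWithDet_rot_iterate k).continuous.continuousOn) hk
      ((disjoint_bigTriangle_image_lowerHalf k).mono_left solid_subset_bigTriangle) subset_rfl

theorem region_eq_solid : region = solid :=
  region_subset_solid.antisymm solid_subset_region

end Kochawave

theorem mainTheorem3 :
    -- the region is a compact plane set of positive finite area, so that its centroid makes sense
    (IsCompact Kochawave.region ∧ 0 < volume Kochawave.region ∧ volume Kochawave.region < ⊤ ∧
      IntegrableOn (fun z : ℂ => z) Kochawave.region volume) ∧
    -- the scales of the four copies
    (∀ z w : ℂ,
      dist (Kochawave.simA z) (Kochawave.simA w) = 1 / 3 * dist z w ∧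
      dist (Kochawave.simB z) (Kochawave.simB w) = 1 / √3 * dist z w ∧
      dist (Kochawave.simC z) (Kochawave.simC w) = 1 / 3 * dist z w ∧
      dist (Kochawave.simD z) (Kochawave.simD w) = 1 / 3 * dist z w) ∧
    -- the dissection into five parts that overlap only in null sets
    (Kochawave.region = ⋃ i, Kochawave.part i) ∧
    (Pairwise fun i j => volume (Kochawave.part i ∩ Kochawave.part j) = 0) ∧
    -- the weights of the parts
    (∀ i, volume.real (Kochawave.part i) = Kochawave.weight i * volume.real Kochawave.region) ∧
    -- the centroid is the weighted mean of the centroids of the parts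
    (Kochawave.centroid Kochawave.region
      = ∑ i, (Kochawave.weight i : ℂ) * Kochawave.centroid (Kochawave.part i)) ∧
    -- the linear equation, its unique solution, and the centroid
    Kochawave.CentroidEquation (Kochawave.centroid Kochawave.region) ∧
    (∀ m : ℂ, Kochawave.CentroidEquation m ↔ m = (59 + 17 * Kochawave.ω) / 111) ∧
    Kochawave.centroid Kochawave.region = (59 + 17 * Kochawave.ω) / 111 := by
  have hpart : Kochawave.part = Kochawave.solidPart := by
    rw [Kochawave.part, Kochawave.solidPart, Kochawave.region_eq_solid]
  rw [hpart, Kochawave.region_eq_solid]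
  exact ⟨⟨Kochawave.isCompact_solid, Kochawave.volume_solid_pos,
      Kochawave.isCompact_solid.measure_lt_top,
      Kochawave.integrableOn_id_of_isCompact Kochawave.isCompact_solid⟩,
    fun z w => ⟨Kochawave.dist_simA z w, Kochawave.dist_simB z w, Kochawave.dist_simC z w,
      Kochawave.dist_simD z w⟩,
    Kochawave.solid_eq_iUnion_solidPart, Kochawave.pairwise_solidPart,
    Kochawave.volumeReal_solidPart, Kochawave.centroid_solid_eq_sum,
    Kochawave.centroidEquation_solid, Kochawave.centroidEquation_iff,
    (Kochawave.centroidEquation_iff _).1 Kochawave.centroidEquation_solid⟩
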